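/- Let the Bernoulli numbers $B_j$ be defined by $\frac{t}{e^t-1}=\sum_{j\ge 0}B_j\frac{t^j}{j!}$, and for a function $f$ of two variables write $\operatorname{Cyc}_{x,y}f(x,y)=f(x,y)+f(y,x)$. Then for all nonnegative integers $r_1,r_2$ and every integer $n\ge r_1+r_2+2$, \begin{align*} &\sum_{k=1}^{2n-1}\frac{B_k}{k!}\frac{B_{2n-k}}{(2n-k)!}\prod_{a=1}^{r_1}(k-a)\prod_{b=1}^{r_2}(2n-k-b)\\ =&\sum_{k=r_1+1}^{2n-r_2-1}\frac{B_k}{k!}\frac{B_{2n-k}}{(2n-k)!}\prod_{a=1}^{r_1}(k-a)\prod_{b=1}^{r_2}(2n-k-b)\\ =&-r_1!\,r_2!\left(\binom{2n-1}{r_1+r_2+1}+\operatorname{Cyc}_{r_1,r_2}(-1)^{r_2}\binom{2n-1}{r_1}\right)\frac{B_{2n}}{(2n)!}\\ &-r_1!\,r_2!\,\operatorname{Cyc}_{r_1,r_2}(-1)^{r_1}\sum_{k=r_1+1}^{r_1+r_2+1}\binom{2n-1-k}{r_1+r_2+1-k}\binom{k-1}{r_1}\frac{B_k}{k!}\frac{B_{2n-k}}{(2n-k)!}.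 \end{align*} -/

import Mathlib

/-- The symmetrisation `Cyc_{x,y} f(x,y) = f(x,y) + f(y,x)`. -/
def cyc (f : ℕ → ℕ → ℚ) (x y : ℕ) : ℚ :=
  f x y + f y x

/-- The product `(B_k / k!) * (B_l / l!)` of normalised Bernoulli numbers, where
`t / (e^t - 1) = ∑ B_j t^j / j!` (so `B_1 = -1/2`, Mathlib's `bernoulli`). -/
def bernoulliProd (k l : ℕ) : ℚ :=
  bernoulli k / (Nat.factorial k : ℚ) * (bernoulli l / (Nat.factorial l : ℚ))

/-- The summand `(B_k / k!) (B_{2n-k} / (2n-k)!) ∏_{a=1}^{r₁} (k-a) ∏_{b=1}^{r₂} (2n-k-b)`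
(used for `1 ≤ k ≤ 2n-1`; the differences in the products are taken in `ℚ`). -/
def weightedTerm (n r₁ r₂ k : ℕ) : ℚ :=
  bernoulliProd k (2 * n - k) *
    (∏ a ∈ Finset.Icc 1 r₁, ((k : ℚ) - (a : ℚ))) *
    (∏ b ∈ Finset.Icc 1 r₂, (2 * (n : ℚ) - (k : ℚ) - (b : ℚ)))

/-!
Let `f(t) = 1 / (e^t - 1) = ∑ b_k t^(k-1)` with `b_k = B_k / k!`. The multiplicativity of the
exponential gives `f(x) f(y) = f(x+y) (1 + f(x) + f(y))` (`bernoulliPowerSeries_addition`). Take the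
homogeneous part corresponding to `N = 2n` at `y = -w`. Since `b_k b_(N-k)` vanishes for odd `k`,
all signs disappear, and after division by `x w (x - w)` this becomes
`∑ b_k b_(N-k) x^(k-1) w^(N-k-1) = -b_N (x^(N-1) - w^(N-1)) / (x - w)
  + ∑_{k ≥ 1} b_k b_(N-k) (x-w)^(k-1) (w^(N-k-1) - x^(N-k-1))`,
where `k` runs over `0, …, N` on the left (`sum_bernoulliProd_divided`).

Now put `x = 1 + X`, `w = 1 + Y` and compare coefficients of `X^(r₁) Y^(r₂)`
(`sum_bernoulliProd_choose`). The left side gives `∑ b_k b_(N-k) C(k-1, r₁) C(N-k-1, r₂)`, which is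
the weighted sum divided by `r₁! r₂!`, together with the two terms `k = 0` and `k = N` involving
`x⁻¹` and `w⁻¹`, which account for the binomials `C(2n-1, r₁)` and `C(2n-1, r₂)`. The quotient
`((1+X)^(N-1) - (1+Y)^(N-1)) / (X - Y)` gives `C(2n-1, r₁+r₂+1)` (`biCoeff_geom_sum`), and since
`x - w = X - Y`, the last sum is cut off at `k = r₁ + r₂ + 1`.
-/

open PowerSeries
-- `map` is left to mean `PowerSeries.map`
open Finset hiding map

/-! ### The addition formula for the Bernoulli generating function -/

theorem rescale_bernoulliPowerSeries_mul {A : Type*} [CommRing A] [Algebra ℚ A] (a : A) :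
    rescale a (bernoulliPowerSeries A) * (rescale a (exp A) - 1) = C a * X := by
  simpa using congrArg (rescale a) (bernoulliPowerSeries_mul_exp_sub_one A)

theorem rescale_exp_sub_one_ne_zero {A : Type*} [CommRing A] [Algebra ℚ A] {a : A} (ha : a ≠ 0) :
    rescale a (exp A) - 1 ≠ 0 := fun h => ha <| by
  simpa [coeff_rescale, coeff_exp, coeff_one] using congrArg (coeff 1) h

/-- The identity `f(a) f(b) = f(a+b) (1 + f(a) + f(b))` for `f(t) = 1 / (e^t - 1)`, in the scaled
variables `at`, `bt` and with the denominators `at`, `bt`, `(a+b)t` cleared. It follows from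
`e^(at) e^(bt) = e^((a+b)t)`. -/
theorem bernoulliPowerSeries_addition {A : Type*} [CommRing A] [IsDomain A] [Algebra ℚ A] {a b : A}
    (ha : a ≠ 0) (hb : b ≠ 0) (hab : a + b ≠ 0) :
    C (a + b) * (rescale a (bernoulliPowerSeries A) * rescale b (bernoulliPowerSeries A)) =
      rescale (a + b) (bernoulliPowerSeries A) *
        (C (a * b) * X + C b * rescale a (bernoulliPowerSeries A)
          + C a * rescale b (bernoulliPowerSeries A)) := by
  have h₁ := rescale_bernoulliPowerSeries_mul a
  have h₂ := rescale_bernoulliPowerSeries_mul b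
  have h₃ := rescale_bernoulliPowerSeries_mul (a + b)
  have n₁ := rescale_exp_sub_one_ne_zero ha
  have n₂ := rescale_exp_sub_one_ne_zero hb
  have n₃ := rescale_exp_sub_one_ne_zero hab
  rw [← exp_mul_exp_eq_exp_add] at h₃ n₃
  refine mul_right_cancel₀ (mul_ne_zero (mul_ne_zero n₁ n₂) n₃) ?_
  set Ba := rescale a (bernoulliPowerSeries A)
  set Bb := rescale b (bernoulliPowerSeries A)
  set Bc := rescale (a + b) (bernoulliPowerSeries A)
  set Ea := rescale a (exp A)
  set Eb := rescale b (exp A)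
  simp only [map_add, map_mul] at h₃ ⊢
  calc _ = (C a + C b) * (Ba * (Ea - 1)) * (Bb * (Eb - 1)) * (Ea * Eb - 1) := by ring
    _ = (C a + C b) * (C a * X) * (C b * X) * (Ea * Eb - 1) := by rw [h₁, h₂]
    _ = ((C a + C b) * X) * (C a * C b * X * ((Ea - 1) * (Eb - 1))
          + C b * ((C a * X) * (Eb - 1)) + C a * ((C b * X) * (Ea - 1))) := by ring
    _ = (Bc * (Ea * Eb - 1)) * (C a * C b * X * ((Ea - 1) * (Eb - 1))
          + C b * ((Ba * (Ea - 1)) * (Eb - 1)) + C a * ((Bb * (Eb - 1)) * (Ea - 1))) := by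
        rw [h₁, h₂, h₃]
    _ = _ := by ring

/-! ### Homogeneous parts of the addition formula -/

theorem bernoulliProd_comm (k l : ℕ) : bernoulliProd k l = bernoulliProd l k := mul_comm _ _

/-- The case `k = 1` relies on `2 ≤ n`: there the other index `2n - 1` is odd and at least `3`. -/
theorem bernoulliProd_eq_zero {n k : ℕ} (hn : 2 ≤ n) (hk : Odd k) (hkn : k ≤ 2 * n) :
    bernoulliProd k (2 * n - k) = 0 := by
  rcases eq_or_ne k 1 with rfl | h1
  · have : bernoulli (2 * n - 1) = 0 := bernoulli_eq_zero_of_odd ⟨n - 1, by omega⟩ (by omega)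
    simp [bernoulliProd, this]
  · have : bernoulli k = 0 := bernoulli_eq_zero_of_odd hk (by obtain ⟨j, rfl⟩ := hk; omega)
    simp [bernoulliProd, this]

theorem coeff_rescale_mul_rescale_bernoulliPowerSeries {A : Type*} [CommRing A] [Algebra ℚ A]
    (a b : A) (N : ℕ) :
    coeff N (rescale a (bernoulliPowerSeries A) * rescale b (bernoulliPowerSeries A)) =
      ∑ k ∈ range (N + 1), bernoulliProd k (N - k) • (a ^ k * b ^ (N - k)) := by
  rw [coeff_mul, Nat.sum_antidiagonal_eq_sum_range_succ_mk]
  refine sum_congr rfl fun k _ => ?_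
  simp only [coeff_rescale, bernoulliPowerSeries, coeff_mk, bernoulliProd, Algebra.smul_def,
    map_mul]
  ring

/-- The part of degree `2n` of the addition formula at `a = x`, `b = -w`. -/
theorem sum_bernoulliProd_addition {A : Type*} [CommRing A] [IsDomain A] [Algebra ℚ A] {x w : A}
    (hx : x ≠ 0) (hw : w ≠ 0) (hxw : x - w ≠ 0) {n : ℕ} (hn : 2 ≤ n) :
    (x - w) * ∑ k ∈ range (2 * n + 1), bernoulliProd k (2 * n - k) • (x ^ k * w ^ (2 * n - k)) =
      ∑ k ∈ range (2 * n + 1), bernoulliProd k (2 * n - k) •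
        ((x - w) ^ k * (x * w ^ (2 * n - k) - w * x ^ (2 * n - k))) := by
  have h := congrArg (coeff (2 * n)) (bernoulliPowerSeries_addition hx (neg_ne_zero.2 hw)
    (by rwa [← sub_eq_add_neg]))
  have hlast : bernoulli (2 * n - 1) = 0 :=
    bernoulli_eq_zero_of_odd ⟨n - 1, by omega⟩ (by omega)
  have hX : coeff (2 * n) (rescale (x - w) (bernoulliPowerSeries A) * X) = 0 := by
    obtain ⟨m, hm⟩ : ∃ m, 2 * n = m + 1 := ⟨2 * n - 1, by omega⟩
    rw [hm, coeff_succ_mul_X, coeff_rescale, bernoulliPowerSeries, coeff_mk,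
      show m = 2 * n - 1 by omega, hlast]
    simp
  rw [← sub_eq_add_neg] at h
  have e : rescale (x - w) (bernoulliPowerSeries A) * (C (x * -w) * X
      + C (-w) * rescale x (bernoulliPowerSeries A)
      + C x * rescale (-w) (bernoulliPowerSeries A)) =
      C (x * -w) * (rescale (x - w) (bernoulliPowerSeries A) * X) +
      C (-w) * (rescale (x - w) (bernoulliPowerSeries A) * rescale x (bernoulliPowerSeries A)) +
      C x * (rescale (x - w) (bernoulliPowerSeries A) * rescale (-w) (bernoulliPowerSeries A)) := by
    ring
  rw [e] at h
  simp only [map_add, coeff_C_mul, hX, coeff_rescale_mul_rescale_bernoulliPowerSeries] at h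
  -- only even `k` contribute, so the sign of `-w` disappears
  have hs : ∀ f : ℕ → A, ∑ k ∈ range (2 * n + 1), bernoulliProd k (2 * n - k) •
      (f k * (-w) ^ (2 * n - k)) =
      ∑ k ∈ range (2 * n + 1), bernoulliProd k (2 * n - k) • (f k * w ^ (2 * n - k)) := by
    refine fun f => sum_congr rfl fun k hk => ?_
    have hk' : k ≤ 2 * n := Nat.lt_succ_iff.1 (mem_range.1 hk)
    rcases Nat.even_or_odd k with he | ho
    · rw [Even.neg_pow ((Nat.even_sub hk').2 (by simp [he]))]
    · simp [bernoulliProd_eq_zero hn ho hk']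
  rw [hs (fun k => x ^ k), hs (fun k => (x - w) ^ k)] at h
  rw [h, mul_zero, zero_add, mul_sum, mul_sum, ← sum_add_distrib]
  refine sum_congr rfl fun k _ => ?_
  rw [mul_smul_comm, mul_smul_comm, ← smul_add]
  congr 1
  ring

/-- The previous identity divided by `x w (x - w)`. The terms `k = 0` and `k = 2n` carry the inverses
`x'`, `w'` and, on the right for `k = 0`, the geometric sum `(x^(m+1) - w^(m+1)) / (x - w)`. -/
theorem sum_bernoulliProd_divided {A : Type*} [CommRing A] [IsDomain A] [Algebra ℚ A]
    {x w x' w' : A} (hx : x * x' = 1) (hw : w * w' = 1) (hxw : x - w ≠ 0) {n m : ℕ} (hn : 2 ≤ n)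
    (hm : 2 * n = m + 2) :
    ∑ k ∈ range (m + 1), bernoulliProd (k + 1) (m + 1 - k) • (x ^ k * w ^ (m - k)) =
      -(bernoulliProd (2 * n) 0 • (∑ i ∈ range (m + 1), x ^ i * w ^ (m - i)
          + x' * w ^ (m + 1) + x ^ (m + 1) * w'))
      + ∑ k ∈ range (m + 1), bernoulliProd (k + 1) (m + 1 - k) •
          ((x - w) ^ k * w ^ (m - k) - (x - w) ^ k * x ^ (m - k))
      + bernoulliProd (2 * n) 0 • ((x - w) ^ (m + 1) * w' - (x - w) ^ (m + 1) * x') := by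
  have hx0 : x ≠ 0 := left_ne_zero_of_mul_eq_one hx
  have hw0 : w ≠ 0 := left_ne_zero_of_mul_eq_one hw
  have h := sum_bernoulliProd_addition hx0 hw0 hxw hn
  have hgeom : (∑ i ∈ range (m + 1), x ^ i * w ^ (m - i)) * (x - w) = x ^ (m + 1) - w ^ (m + 1) :=
    (Commute.all x w).geom_sum₂_mul (m + 1)
  rw [hm, sum_range_succ, sum_range_succ', sum_range_succ _ (m + 2), sum_range_succ' _ (m + 1)] at h
  have e₁ : ∑ k ∈ range (m + 1), bernoulliProd (k + 1) (m + 2 - (k + 1)) •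
      (x ^ (k + 1) * w ^ (m + 2 - (k + 1))) =
      x * w * ∑ k ∈ range (m + 1), bernoulliProd (k + 1) (m + 1 - k) • (x ^ k * w ^ (m - k)) := by
    rw [mul_sum]
    refine sum_congr rfl fun k hk => ?_
    have : k ≤ m := Nat.lt_succ_iff.1 (mem_range.1 hk)
    rw [show m + 2 - (k + 1) = m + 1 - k by omega, show m + 1 - k = (m - k) + 1 by omega,
      mul_smul_comm]
    ring_nf
  have e₂ : ∑ k ∈ range (m + 1), bernoulliProd (k + 1) (m + 2 - (k + 1)) •
      ((x - w) ^ (k + 1) * (x * w ^ (m + 2 - (k + 1)) - w * x ^ (m + 2 - (k + 1)))) =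
      x * w * (x - w) * ∑ k ∈ range (m + 1), bernoulliProd (k + 1) (m + 1 - k) •
          ((x - w) ^ k * w ^ (m - k) - (x - w) ^ k * x ^ (m - k)) := by
    rw [mul_sum]
    refine sum_congr rfl fun k hk => ?_
    have : k ≤ m := Nat.lt_succ_iff.1 (mem_range.1 hk)
    rw [show m + 2 - (k + 1) = m + 1 - k by omega, show m + 1 - k = (m - k) + 1 by omega,
      mul_smul_comm]
    congr 1
    ring
  rw [e₁, e₂, bernoulliProd_comm 0] at h
  refine mul_left_cancel₀ (mul_ne_zero (mul_ne_zero hx0 hw0) hxw) ?_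
  rw [hm]
  simp only [Algebra.smul_def, Nat.sub_self, Nat.sub_zero, pow_zero, mul_one, one_mul] at h ⊢
  generalize algebraMap ℚ A (bernoulliProd (m + 2) 0) = c at *
  generalize ∑ k ∈ range (m + 1), algebraMap ℚ A _ * (x ^ k * w ^ (m - k)) = S at *
  generalize ∑ k ∈ range (m + 1), algebraMap ℚ A _ * (_ - _) = T at *
  generalize ∑ i ∈ range (m + 1), x ^ i * w ^ (m - i) = G at *
  linear_combination h + c * x * w * hgeom
    + c * w ^ (m + 2) * (x - w) * hx + c * x ^ (m + 2) * (x - w) * hw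
    - c * (x - w) ^ (m + 2) * (x * hw - w * hx)

/-! ### Coefficients of power series in two variables -/

/-- The coefficient of `X^r Y^s` of a power series in two variables, encoded as an element of
`ℚ⟦X⟧⟦Y⟧`: the inner variable `X` is `C X`, the outer variable `Y` is `X`, and a series `q` in the
outer variable alone is `map C q`. -/
noncomputable def biCoeff (r s : ℕ) : ℚ⟦X⟧⟦X⟧ →ₗ[ℚ] ℚ :=
  (coeff r : ℚ⟦X⟧ →ₗ[ℚ] ℚ) ∘ₗ (coeff s : ℚ⟦X⟧⟦X⟧ →ₗ[ℚ⟦X⟧] ℚ⟦X⟧).restrictScalars ℚ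

theorem biCoeff_C_mul_map (r s : ℕ) (p q : ℚ⟦X⟧) :
    biCoeff r s (C p * map C q) = coeff r p * coeff s q := by
  simp [biCoeff, mul_comm _ (C _)]
  ring

theorem C_X_sub_X_pow (m : ℕ) : (C X - X : ℚ⟦X⟧⟦X⟧) ^ m =
    ∑ i ∈ range (m + 1), ((-1) ^ (m - i) * (m.choose i : ℚ)) •
      (C (X ^ i) * map C (X ^ (m - i))) := by
  rw [sub_eq_add_neg, add_pow]
  refine sum_congr rfl fun i _ => ?_
  rw [neg_pow, Algebra.smul_def]
  simp
  ring

theorem biCoeff_sub_pow_mul_map (r s m : ℕ) (q : ℚ⟦X⟧) :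
    biCoeff r s ((C X - X) ^ m * map C q) =
      (-1) ^ (m - r) * (m.choose r : ℚ) * coeff s (X ^ (m - r) * q) := by
  rw [C_X_sub_X_pow, sum_mul, map_sum]
  have : ∀ i ∈ range (m + 1), biCoeff r s (((-1) ^ (m - i) * (m.choose i : ℚ)) •
      (C (X ^ i) * map C (X ^ (m - i))) * map C q) =
      if r = i then (-1) ^ (m - r) * (m.choose r : ℚ) * coeff s (X ^ (m - r) * q) else 0 := by
    intro i _
    rw [smul_mul_assoc, mul_assoc, ← map_mul, map_smul, biCoeff_C_mul_map, coeff_X_pow]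
    split_ifs with h
    · subst h; simp
    · simp
  rw [sum_congr rfl this, sum_ite_eq]
  split_ifs with h
  · rfl
  · rw [Nat.choose_eq_zero_of_lt (by simpa using h)]; simp

theorem biCoeff_sub_pow_mul_C (r s m : ℕ) (p : ℚ⟦X⟧) :
    biCoeff r s ((C X - X) ^ m * C p) =
      (-1) ^ s * (m.choose s : ℚ) * coeff r (X ^ (m - s) * p) := by
  rw [C_X_sub_X_pow, sum_mul, map_sum]
  have : ∀ i ∈ range (m + 1), biCoeff r s (((-1) ^ (m - i) * (m.choose i : ℚ)) •
      (C (X ^ i) * map C (X ^ (m - i))) * C p) =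
      if m - s = i ∧ s ≤ m then
        (-1) ^ s * (m.choose s : ℚ) * coeff r (X ^ (m - s) * p) else 0 := by
    intro i hi
    have hi' : i ≤ m := Nat.lt_succ_iff.1 (mem_range.1 hi)
    rw [smul_mul_assoc, mul_right_comm, ← map_mul, map_smul, biCoeff_C_mul_map, coeff_X_pow]
    by_cases h : m - s = i ∧ s ≤ m
    · obtain ⟨rfl, hs⟩ := h
      rw [if_pos (by omega), if_pos ⟨rfl, hs⟩, Nat.sub_sub_self hs, Nat.choose_symm hs]
      simp
    · rw [if_neg h, if_neg (by omega)]
      simp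
  rw [sum_congr rfl this]
  by_cases h : s ≤ m
  · simp only [h, and_true]
    rw [sum_ite_eq, if_pos (by simp)]
  · rw [Nat.choose_eq_zero_of_lt (not_le.1 h)]; simp [h]

theorem coeff_one_add_X_pow' (m r : ℕ) : coeff r ((1 + X : ℚ⟦X⟧) ^ m) = (m.choose r : ℚ) := by
  have := Polynomial.coeff_one_add_X_pow ℚ m r
  rw [← Polynomial.coeff_coe] at this
  simpa using this

theorem one_add_X_mul_mk_neg_one_pow : (1 + X : ℚ⟦X⟧) * mk (fun n => (-1) ^ n) = 1 := by
  ext n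
  cases n with
  | zero => simp
  | succ n => simp [add_mul, coeff_succ_X_mul, coeff_one, pow_succ]

/-- Here `∑ i, (1+X)^i (1+Y)^(m-i) = ((1+X)^(m+1) - (1+Y)^(m+1)) / (X - Y)`. Expanding the powers
by the binomial theorem and dividing termwise leaves one monomial `X^r Y^s`, in degree `r + s`. -/
theorem biCoeff_geom_sum (r s m : ℕ) :
    biCoeff r s (∑ i ∈ range (m + 1), C ((1 + X) ^ i) * map C ((1 + X) ^ (m - i))) =
      ((m + 1).choose (r + s + 1) : ℚ) := by
  have hne : (C X - X : ℚ⟦X⟧⟦X⟧) ≠ 0 := fun h => by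
    simpa [coeff_C, coeff_X] using congrArg (coeff 1) h
  have key : ∑ i ∈ range (m + 1), C ((1 + X) ^ i) * map C ((1 + X) ^ (m - i)) =
      ∑ l ∈ range (m + 1), ((m + 1).choose (l + 1) : ℚ) •
        ∑ i ∈ range (l + 1), (C (X ^ i) * map C (X ^ (l - i)) : ℚ⟦X⟧⟦X⟧) := by
    refine mul_right_cancel₀ hne ?_
    have g₁ := (Commute.all (1 + C X : ℚ⟦X⟧⟦X⟧) (1 + X)).geom_sum₂_mul (m + 1)
    conv_rhs => rw [sum_mul]
    have g₂ : ∀ l : ℕ, (((m + 1).choose (l + 1) : ℚ) •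
        ∑ i ∈ range (l + 1), (C (X ^ i) * map C (X ^ (l - i)) : ℚ⟦X⟧⟦X⟧)) * (C X - X) =
        (C X ^ (l + 1) * ((m + 1).choose (l + 1) : ℚ⟦X⟧⟦X⟧) -
          X ^ (l + 1) * ((m + 1).choose (l + 1) : ℚ⟦X⟧⟦X⟧)) := by
      intro l
      have := (Commute.all (C X : ℚ⟦X⟧⟦X⟧) X).geom_sum₂_mul (l + 1)
      simp only [Nat.add_sub_cancel] at this
      simp only [map_pow, map_X, Algebra.smul_def, map_natCast]
      rw [mul_assoc, this]; ring
    rw [sum_congr rfl fun l _ => g₂ l, sum_sub_distrib]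
    have a₁ := add_pow (C X : ℚ⟦X⟧⟦X⟧) 1 (m + 1)
    have a₂ := add_pow (X : ℚ⟦X⟧⟦X⟧) 1 (m + 1)
    rw [sum_range_succ'] at a₁ a₂
    simp only [one_pow, mul_one, pow_zero] at a₁ a₂
    rw [eq_sub_of_add_eq a₁.symm, eq_sub_of_add_eq a₂.symm]
    simp only [map_pow, map_add, map_one, map_X, Nat.add_sub_cancel] at g₁ ⊢
    rw [show (C X - X : ℚ⟦X⟧⟦X⟧) = 1 + C X - (1 + X) by ring, g₁]
    ring
  rw [key, map_sum]
  have : ∀ l ∈ range (m + 1), biCoeff r s (((m + 1).choose (l + 1) : ℚ) •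
        ∑ i ∈ range (l + 1), (C (X ^ i) * map C (X ^ (l - i)) : ℚ⟦X⟧⟦X⟧)) =
      if r + s = l then ((m + 1).choose (r + s + 1) : ℚ) else 0 := by
    intro l _
    rw [map_smul, map_sum]
    simp only [biCoeff_C_mul_map, coeff_X_pow, ite_mul, one_mul, zero_mul]
    rw [sum_ite_eq]
    by_cases h : r + s = l
    · subst h; simp
    · simp only [h, if_false, mem_range]
      split_ifs <;> first | omega | simp
  rw [sum_congr rfl this, sum_ite_eq]
  split_ifs with h
  · rfl
  · rw [Nat.choose_eq_zero_of_lt (by simp at h; omega)]; simp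

/-! ### Extracting coefficients -/

/-- The coefficient of `X^r Y^s` in `sum_bernoulliProd_divided` at `x = 1 + X`, `w = 1 + Y`. -/
theorem sum_bernoulliProd_choose {n m : ℕ} (r s : ℕ) (hn : 2 ≤ n)
    (hm : 2 * n = m + 2) (hrs : r + s ≤ m) :
    ∑ k ∈ range (m + 1), bernoulliProd (k + 1) (m + 1 - k) *
        ((k.choose r : ℚ) * ((m - k).choose s : ℚ)) =
      -(bernoulliProd (2 * n) 0 * (((m + 1).choose (r + s + 1) : ℚ)
          + (-1) ^ r * ((m + 1).choose s : ℚ) + (-1) ^ s * ((m + 1).choose r : ℚ)))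
      + ∑ k ∈ range (m + 1), bernoulliProd (k + 1) (m + 1 - k) *
          ((-1) ^ (k - r) * (k.choose r : ℚ) * coeff s (X ^ (k - r) * (1 + X : ℚ⟦X⟧) ^ (m - k))
          - (-1) ^ s * (k.choose s : ℚ) * coeff r (X ^ (k - s) * (1 + X : ℚ⟦X⟧) ^ (m - k))) := by
  have hx : (C (1 + X) * C (mk fun n => (-1) ^ n) : ℚ⟦X⟧⟦X⟧) = 1 := by
    rw [← map_mul, one_add_X_mul_mk_neg_one_pow, map_one]
  have hw : (map C (1 + X) * map C (mk fun n => (-1) ^ n) : ℚ⟦X⟧⟦X⟧) = 1 := by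
    rw [← map_mul, one_add_X_mul_mk_neg_one_pow, map_one]
  have hxw : (C (1 + X) - map C (1 + X) : ℚ⟦X⟧⟦X⟧) = C X - X := by simp
  have hne : (C X - X : ℚ⟦X⟧⟦X⟧) ≠ 0 := fun h => by
    simpa [coeff_C, coeff_X] using congrArg (coeff 1) h
  have h := congrArg (biCoeff r s) (sum_bernoulliProd_divided hx hw (hxw ▸ hne) hn hm)
  simp only [hxw, ← map_pow] at h
  simp only [map_add, map_sub, map_neg, map_smul, map_sum _ (fun _ => _ • _)] at h
  rw [biCoeff_geom_sum] at h
  simp only [biCoeff_C_mul_map, biCoeff_sub_pow_mul_map, biCoeff_sub_pow_mul_C,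
    coeff_one_add_X_pow', coeff_mk, smul_eq_mul] at h
  -- the terms with `k = 2n` on the right have degree at least `m + 1 > r + s`
  rw [coeff_X_pow_mul', coeff_X_pow_mul', if_neg (by omega), if_neg (by omega)] at h
  rw [h]
  ring

/-! ### The weighted sums -/

theorem prod_Icc_sub_eq_choose (m r : ℕ) :
    ∏ a ∈ Icc 1 r, (((m + 1 : ℕ) : ℚ) - (a : ℚ)) = (r.factorial : ℚ) * (m.choose r : ℚ) := by
  rw [← Nat.cast_mul, ← Nat.descFactorial_eq_factorial_mul_choose]
  induction r with
  | zero => simp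
  | succ r ih =>
    rw [prod_Icc_succ_top (by omega), ih, Nat.descFactorial_succ]
    rcases le_or_gt r m with h | h
    · push_cast [Nat.cast_sub h]; ring
    · simp [Nat.descFactorial_eq_zero_iff_lt.2 h]

theorem weightedTerm_succ {n m k : ℕ} (r₁ r₂ : ℕ) (hm : 2 * n = m + 2) (hk : k ≤ m) :
    weightedTerm n r₁ r₂ (k + 1) = (r₁.factorial : ℚ) * (r₂.factorial : ℚ) *
      (bernoulliProd (k + 1) (m + 1 - k) * ((k.choose r₁ : ℚ) * ((m - k).choose r₂ : ℚ))) := by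
  have h : 2 * (n : ℚ) - ((k + 1 : ℕ) : ℚ) = ((m - k + 1 : ℕ) : ℚ) := by
    have : (2 * n : ℚ) = m + 2 := by exact_mod_cast hm
    push_cast [Nat.cast_sub hk]
    linarith
  rw [weightedTerm, h, prod_Icc_sub_eq_choose, prod_Icc_sub_eq_choose,
    show 2 * n - (k + 1) = m + 1 - k by omega]
  ring

theorem sum_Icc_one_eq_sum_range {M : Type*} [AddCommMonoid M] (f : ℕ → M) (m : ℕ) :
    ∑ k ∈ Icc 1 (m + 1), f k = ∑ k ∈ range (m + 1), f (k + 1) := by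
  rw [range_eq_Ico, sum_Ico_add' f 0 (m + 1) 1, zero_add, ← Ico_succ_right_eq_Icc]
  rfl

/-- Outside the smaller range, one of the two products has a zero factor. -/
theorem sum_weightedTerm_Icc_restrict {r₁ r₂ n : ℕ} (hn : r₁ + r₂ + 2 ≤ n) :
    ∑ k ∈ Icc 1 (2 * n - 1), weightedTerm n r₁ r₂ k =
      ∑ k ∈ Icc (r₁ + 1) (2 * n - r₂ - 1), weightedTerm n r₁ r₂ k := by
  symm
  refine sum_subset (Icc_subset_Icc (by omega) (by omega)) fun k hk hk' => ?_
  obtain ⟨m, hm⟩ : ∃ m, 2 * n = m + 2 := ⟨2 * n - 2, by omega⟩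
  obtain ⟨k, rfl⟩ : ∃ j, k = j + 1 := ⟨k - 1, by simp at hk; omega⟩
  simp only [mem_Icc] at hk hk'
  rw [weightedTerm_succ r₁ r₂ hm (by omega)]
  rcases lt_or_ge k r₁ with h | h
  · simp [Nat.choose_eq_zero_of_lt h]
  · simp [Nat.choose_eq_zero_of_lt (show m - k < r₂ by omega)]

/-- The coefficient of the series restricts the sum to `k ≤ p + q`, the binomial coefficient to
`p ≤ k`. -/
theorem sum_bernoulliProd_choose_mul_coeff {n m p q : ℕ} (hm : 2 * n = m + 2)
    (hpq : p + q ≤ m) :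
    ∑ k ∈ range (m + 1), bernoulliProd (k + 1) (m + 1 - k) *
        ((k.choose p : ℚ) * coeff q (X ^ (k - p) * (1 + X : ℚ⟦X⟧) ^ (m - k))) =
      ∑ k ∈ Icc (p + 1) (p + q + 1),
        ((2 * n - 1 - k).choose (p + q + 1 - k) : ℚ) * ((k - 1).choose p : ℚ) *
          bernoulliProd k (2 * n - k) := by
  have : ∑ k ∈ Icc (p + 1) (p + q + 1),
        ((2 * n - 1 - k).choose (p + q + 1 - k) : ℚ) * ((k - 1).choose p : ℚ) *
          bernoulliProd k (2 * n - k) = ∑ k ∈ Icc 1 (m + 1),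
        bernoulliProd k (2 * n - k) * (((k - 1).choose p : ℚ) *
          coeff q (X ^ (k - 1 - p) * (1 + X : ℚ⟦X⟧) ^ (2 * n - 1 - k))) := by
    refine sum_subset_zero_on_sdiff (Icc_subset_Icc (by omega) (by omega)) ?_ ?_
    · intro k hk
      simp only [mem_sdiff, mem_Icc] at hk
      rcases lt_or_ge (k - 1) p with h | h
      · simp [Nat.choose_eq_zero_of_lt h]
      · rw [coeff_X_pow_mul', if_neg (by omega)]; simp
    · intro k hk
      simp only [mem_Icc] at hk
      rw [coeff_X_pow_mul', if_pos (by omega), coeff_one_add_X_pow',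
        show q - (k - 1 - p) = p + q + 1 - k by omega]
      ring
  rw [this, sum_Icc_one_eq_sum_range]
  refine sum_congr rfl fun k hk => ?_
  rw [show 2 * n - (k + 1) = m + 1 - k by omega, show 2 * n - 1 - (k + 1) = m - k by omega,
    Nat.add_sub_cancel]

/-- Only even indices `k + 1` contribute, so the sign `(-1)^(k-r)` is `-(-1)^r` throughout. -/
theorem sum_bernoulliProd_mul_neg_one_pow_sub {n m : ℕ} (r : ℕ) (hn : 2 ≤ n) (hm : 2 * n = m + 2)
    (f : ℕ → ℚ) :
    ∑ k ∈ range (m + 1), bernoulliProd (k + 1) (m + 1 - k) *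
        ((-1) ^ (k - r) * (k.choose r : ℚ) * f k) =
      -(-1) ^ r * ∑ k ∈ range (m + 1), bernoulliProd (k + 1) (m + 1 - k) *
        ((k.choose r : ℚ) * f k) := by
  rw [mul_sum]
  refine sum_congr rfl fun k hk => ?_
  have hkm : k ≤ m := Nat.lt_succ_iff.1 (mem_range.1 hk)
  rcases lt_or_ge k r with h | h
  · simp [Nat.choose_eq_zero_of_lt h]
  rcases Nat.even_or_odd k with he | ho
  · have := bernoulliProd_eq_zero hn he.add_one (by omega)
    rw [show 2 * n - (k + 1) = m + 1 - k by omega] at this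
    simp [this]
  · have hsgn : (-1 : ℚ) ^ (k - r) = -(-1) ^ r := by
      have h1 : (-1 : ℚ) ^ (k - r) * (-1) ^ r = -1 := by
        rw [← pow_add, Nat.sub_add_cancel h, ho.neg_one_pow]
      have h2 : (-1 : ℚ) ^ r * (-1) ^ r = 1 := by rw [← mul_pow]; simp
      linear_combination (-1 : ℚ) ^ r * h1 - (-1 : ℚ) ^ (k - r) * h2
    rw [hsgn]; ring

theorem theorem2p4 (r₁ r₂ n : ℕ) (hn : r₁ + r₂ + 2 ≤ n) :
    (∑ k ∈ Finset.Icc 1 (2 * n - 1), weightedTerm n r₁ r₂ k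
      = ∑ k ∈ Finset.Icc (r₁ + 1) (2 * n - r₂ - 1), weightedTerm n r₁ r₂ k) ∧
    (∑ k ∈ Finset.Icc (r₁ + 1) (2 * n - r₂ - 1), weightedTerm n r₁ r₂ k
      = -((Nat.factorial r₁ : ℚ) * (Nat.factorial r₂ : ℚ)) *
          (((2 * n - 1).choose (r₁ + r₂ + 1) : ℚ)
            + cyc (fun p q => (-1 : ℚ) ^ q * ((2 * n - 1).choose p : ℚ)) r₁ r₂) *
          (bernoulli (2 * n) / (Nat.factorial (2 * n) : ℚ))
        - (Nat.factorial r₁ : ℚ) * (Nat.factorial r₂ : ℚ) *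
          cyc (fun p q => (-1 : ℚ) ^ p *
            ∑ k ∈ Finset.Icc (p + 1) (p + q + 1),
              ((2 * n - 1 - k).choose (p + q + 1 - k) : ℚ) * ((k - 1).choose p : ℚ) *
                bernoulliProd k (2 * n - k)) r₁ r₂) := by
  refine ⟨sum_weightedTerm_Icc_restrict hn, ?_⟩
  obtain ⟨m, hm⟩ : ∃ m, 2 * n = m + 2 := ⟨2 * n - 2, by omega⟩
  have hn2 : 2 ≤ n := by omega
  have hβ : bernoulliProd (2 * n) 0 = bernoulli (2 * n) / (Nat.factorial (2 * n) : ℚ) := by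
    simp [bernoulliProd]
  have hs : ∑ k ∈ range (m + 1), bernoulliProd (k + 1) (m + 1 - k) *
      ((-1) ^ r₂ * (k.choose r₂ : ℚ) * coeff r₁ (X ^ (k - r₂) * (1 + X : ℚ⟦X⟧) ^ (m - k))) =
      (-1) ^ r₂ * ∑ k ∈ range (m + 1), bernoulliProd (k + 1) (m + 1 - k) *
        ((k.choose r₂ : ℚ) * coeff r₁ (X ^ (k - r₂) * (1 + X : ℚ⟦X⟧) ^ (m - k))) := by
    rw [mul_sum]
    exact sum_congr rfl fun k _ => by ring
  have h := sum_bernoulliProd_choose r₁ r₂ hn2 hm (by omega)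
  simp only [mul_sub, sum_sub_distrib] at h
  rw [sum_bernoulliProd_mul_neg_one_pow_sub r₁ hn2 hm, hs,
    sum_bernoulliProd_choose_mul_coeff hm (by omega),
    sum_bernoulliProd_choose_mul_coeff hm (by omega), hβ] at h
  rw [← sum_weightedTerm_Icc_restrict hn, show 2 * n - 1 = m + 1 by omega,
    sum_Icc_one_eq_sum_range, sum_congr rfl fun k hk => weightedTerm_succ r₁ r₂ hm
      (Nat.lt_succ_iff.1 (mem_range.1 hk)), ← mul_sum, h]
  simp only [cyc, show 2 * n - 1 = m + 1 by omega]
  ring
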